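/- Let $\mathcal X=\mathcal Y^*$ be the dual of a separable real Banach space $\mathcal Y$, let $\mathcal H$ be a real Hilbert space, let $A:\mathcal X\to\mathcal H$ be bounded and linear, and let $J:\mathcal X\to[0,\infty]$ be proper, convex, weak$^*$ lower semicontinuous and absolutely one-homogeneous ($J(cu)=|c|J(u)$ for $c\in\mathbb R$, with $0\cdot\infty=0$). Put $\mathcal N(J)=\{u: J(u)=0\}$ and $\mathrm{dom}(J)=\{u: J(u)<\infty\}$. Assume: (1) on $\mathcal N(J)$, $u\mapsto\|Au\|$ is a norm equivalent to $\|\cdot\|_{\mathcal X}$; (2) there is $C>0$ with $\|u-\mathcal P^A(Au)\|_{\mathcal X}\le C\,J(u)$ for all $u\in\mathcal X$, where $\mathcal P^A(h)=\mathrm{argmin}_{w\in\mathcal N(J)}\|Aw-h\|$; (3) if $u_k\to u$ weakly$^*$ in $\mathcal X$, then $Au_k\to Au$ weakly in $\mathcal H$. Let $f\in\mathcal H$ be such that $u\notin\mathcal N(J)$ whenever $Au=f$. For $\alpha,\beta\ge 1$ and $t>0$ let $$E_t^{\alpha,\beta}(u)=\tfrac1\alpha\|Au-f\|^\alpha+\tfrac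 t\beta J(u)^\beta,\qquad u\in\mathcal X .$$ Let $1\le\alpha<2$ and $\beta\ge1$ with $\alpha>1$ or $\beta>1$. Then for every $t>0$ minimizers $u_t$ of $E^{\alpha,\beta}_t$ exist and all have the same image $Au_t$. The resulting forward solution path $t\mapsto Au_t$ is Lipschitz continuous on $(\delta,\infty)$ for every $\delta>0$, and its derivative $(Au_t)'$ exists for almost every $t\in(\delta,\infty)$. If moreover $1<\alpha<2$ and $\beta=1$, then with $R(t)=\|Au_t-f\|$, for almost every $t\in(0,\infty)$, $$\|(Au_t)'\|\le\frac1{\alpha-1}\,\frac{R(t)}t\le\frac1{\alpha-1}\,\frac{\|f\|}t .$$ If in addition the range condition holds, i.e. $Au^\dagger=f$ for some $u^\dagger\in\mathrm{dom}(J)$, then for almost every $t\in(0,\infty)$ $$\|(Au_t)'\|\le\frac1{\alpha-1}\,C_R\,t^{\frac{1-\alpha}{\alpha}},\qquad C_R=J_{\min}^{\beta/\alpha},\quad J_{\min}=\inf\{J(u): Au=f\}.$$ If also the source condition holds, i.e. there are $u^\dagger\in\mathrm{dom}(J)$ with $Au^\dagger=f$ and $q\in\mathcal H$ with $A^*q\in\partial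 J(u^\dagger)$, then for almost every $t\in(0,\infty)$ $$\|(Au_t)'\|\le\frac1{\alpha-1}\,C_S\,t^{\frac{2-\alpha}{\alpha-1}},\qquad C_S=s_*^{\frac1{\alpha-1}}J_{\min}^{\frac{\beta-1}{\alpha-1}},$$ where $s_*$ is the infimum of $\|q\|$ over all $q\in\mathcal H$ such that $A^*q\in\partial J(u^\dagger)$ for some $u^\dagger\in\mathrm{dom}(J)$ with $Au^\dagger=f$. -/

import Mathlib

open scoped NNReal ENNReal Topology

noncomputable section

namespace VarReg

variable {Y : Type*} [NormedAddCommGroup Y] [NormedSpace ℝ Y]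
  {H : Type*} [NormedAddCommGroup H] [InnerProductSpace ℝ H]

/-- `J : X → ℝ₊ ∪ {∞}`, on the dual `X` of `Y`, is proper, convex, absolutely one-homogeneous and
weak-* lower semicontinuous. -/
structure IsRegularizer (J : StrongDual ℝ Y → ℝ≥0∞) : Prop where
  proper : ∃ u, J u ≠ ∞
  convex : ∀ u v : StrongDual ℝ Y, ∀ a b : ℝ, 0 ≤ a → 0 ≤ b → a + b = 1 →
    J (a • u + b • v) ≤ ENNReal.ofReal a * J u + ENNReal.ofReal b * J v
  homogeneous : ∀ (c : ℝ) (u : StrongDual ℝ Y), J (c • u) = ENNReal.ofReal |c| * J u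
  weakStar_lsc : LowerSemicontinuous (fun u : WeakDual ℝ Y => J (WeakDual.toStrongDual u))

/-- The null space `N(J) = {u : J u = 0}`. -/
def nullSpace (J : StrongDual ℝ Y → ℝ≥0∞) : Set (StrongDual ℝ Y) := {u | J u = 0}

/-- On `N(J)`, the map `u ↦ ‖A u‖` is a norm equivalent to the norm of `X` (definiteness is part of
the lower bound). -/
def NormEquivOnNull (A : StrongDual ℝ Y →L[ℝ] H) (J : StrongDual ℝ Y → ℝ≥0∞) : Prop :=
  ∃ c > (0 : ℝ), ∃ C > (0 : ℝ), ∀ u ∈ nullSpace J, c * ‖u‖ ≤ ‖A u‖ ∧ ‖A u‖ ≤ C * ‖u‖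

/-- `w` is the `A`-orthogonal projection of `h ∈ H` onto `N(J)`:
a minimizer over `N(J)` of `w ↦ ‖A w - h‖`. -/
def IsAProj (A : StrongDual ℝ Y →L[ℝ] H) (J : StrongDual ℝ Y → ℝ≥0∞)
    (h : H) (w : StrongDual ℝ Y) : Prop :=
  w ∈ nullSpace J ∧ IsMinOn (fun v => ‖A v - h‖) (nullSpace J) w

/-- Generalized Poincaré inequality `‖u - P(A u)‖ ≤ C J(u)`, where `P` is the `A`-orthogonal
projection onto `N(J)`. -/
def PoincareIneq (A : StrongDual ℝ Y →L[ℝ] H) (J : StrongDual ℝ Y → ℝ≥0∞) : Prop :=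
  ∃ C > (0 : ℝ), ∀ u w : StrongDual ℝ Y, IsAProj A J (A u) w →
    ENNReal.ofReal ‖u - w‖ ≤ ENNReal.ofReal C * J u

/-- `A` maps weak-* convergent sequences to weakly convergent sequences. -/
def WeakStarToWeak (A : StrongDual ℝ Y →L[ℝ] H) : Prop :=
  ∀ (u : ℕ → StrongDual ℝ Y) (u₀ : StrongDual ℝ Y),
    Filter.Tendsto (fun k => StrongDual.toWeakDual (u k)) Filter.atTop
      (𝓝 (StrongDual.toWeakDual u₀)) →
    Filter.Tendsto (fun k => toWeakSpace ℝ H (A (u k))) Filter.atTop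
      (𝓝 (toWeakSpace ℝ H (A u₀)))

/-- The energy `E(u) = (1/α) ‖A u - f‖ ^ α + (t/β) J(u) ^ β`. -/
def energy (A : StrongDual ℝ Y →L[ℝ] H) (J : StrongDual ℝ Y → ℝ≥0∞) (f : H) (α β t : ℝ)
    (u : StrongDual ℝ Y) : ℝ≥0∞ :=
  ENNReal.ofReal (1 / α * ‖A u - f‖ ^ α) + ENNReal.ofReal (t / β) * J u ^ β

/-- The set `{A u : u minimizes the energy with parameter t}`. -/
def forwardSolutions (A : StrongDual ℝ Y →L[ℝ] H) (J : StrongDual ℝ Y → ℝ≥0∞) (f : H)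
    (α β t : ℝ) : Set H :=
  A '' {u | IsMinOn (energy A J f α β t) Set.univ u}

/-- The subdifferential of `J` at `u`, a subset of the dual of `X` (empty for `u ∉ dom J`). -/
def subdiff (J : StrongDual ℝ Y → ℝ≥0∞) (u : StrongDual ℝ Y) :
    Set (StrongDual ℝ (StrongDual ℝ Y)) :=
  {p | J u ≠ ∞ ∧ ∀ v, (J u : EReal) + ((p (v - u) : ℝ) : EReal) ≤ (J v : EReal)}

/-- The Banach space adjoint `A* : H → X*`, `⟨A* q, v⟩ = ⟨q, A v⟩`. -/
def adj (A : StrongDual ℝ Y →L[ℝ] H) (q : H) : StrongDual ℝ (StrongDual ℝ Y) :=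
  (innerSL ℝ q).comp A

/-- Range condition: some `u ∈ dom J` satisfies `A u = f`. -/
def RangeCond (A : StrongDual ℝ Y →L[ℝ] H) (J : StrongDual ℝ Y → ℝ≥0∞) (f : H) : Prop :=
  ∃ u, J u ≠ ∞ ∧ A u = f

/-- `q` is a source element: `A* q ∈ ∂J(u)` for some `u ∈ dom J` with `A u = f`. -/
def IsSourceElement (A : StrongDual ℝ Y →L[ℝ] H) (J : StrongDual ℝ Y → ℝ≥0∞) (f q : H) : Prop :=
  ∃ u, (J u ≠ ∞ ∧ A u = f) ∧ adj A q ∈ subdiff J u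

/-- Range and source condition hold for a common `u`. -/
def RangeSourceCond (A : StrongDual ℝ Y →L[ℝ] H) (J : StrongDual ℝ Y → ℝ≥0∞) (f : H) : Prop :=
  ∃ q, IsSourceElement A J f q

/-- `J_min = inf {J u : A u = f}` (finite under the range condition). -/
def Jmin (A : StrongDual ℝ Y →L[ℝ] H) (J : StrongDual ℝ Y → ℝ≥0∞) (f : H) : ℝ :=
  (sInf (J '' {u | A u = f})).toReal

/-- `s_* = inf {‖q‖ : q is a source element}`. -/
def sStar (A : StrongDual ℝ Y →L[ℝ] H) (J : StrongDual ℝ Y → ℝ≥0∞) (f : H) : ℝ :=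
  sInf (norm '' {q : H | IsSourceElement A J f q})

/-- `C_R = J_min ^ (β/α)`. -/
def rangeConst (A : StrongDual ℝ Y →L[ℝ] H) (J : StrongDual ℝ Y → ℝ≥0∞) (f : H) (α β : ℝ) : ℝ :=
  Jmin A J f ^ (β / α)

/-- `C_S = s_* ^ (1/(α-1)) J_min ^ ((β-1)/(α-1))`. -/
def sourceConst (A : StrongDual ℝ Y →L[ℝ] H) (J : StrongDual ℝ Y → ℝ≥0∞) (f : H) (α β : ℝ) : ℝ :=
  sStar A J f ^ (1 / (α - 1)) * Jmin A J f ^ ((β - 1) / (α - 1))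

end VarReg

end

namespace VarReg

open MeasureTheory Filter

/-! Let u minimize the energy at t, with j = J(u) and R = ‖Au - f‖. Comparing u with points of a
segment towards v and differentiating at its start gives ⟨f - Au, Av - Au⟩ ≤ σ (J(v) - j) with σ = t
j^(β-1) R^(2-α) (`IsMinimizer.inner_le`). Thus Au is a proximal point of f with parameter σ, and two
minimizers, at t ≤ s, can be compared as proximal points with parameters σ and τ. With D the
distance of their images and k ≤ j the value of J at the second one, this yields D² ≤ (τ - σ)(j - k)
and σD ≤ (τ - σ)R.

For 1 < α < 2, inserting ‖Av - f‖ ≤ R + D into τ turns the second inequality into ((R + D)/R)^(α-1)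
≤ s/t (`norm_sub_le_of_one_lt`). This gives local Lipschitz continuity, and division by s - t as s ↓
t gives |(Au_t)'| ≤ R/((α-1)t). For α = 1 that exponent vanishes; β > 1 is used instead to bound j -
k by a multiple of s - t, and the first inequality becomes quadratic in D (`norm_sub_le_of_eq_one`).
Taking s = t shows that the image is unique.

Existence is the direct method, with coercivity from the Poincaré inequality. Almost everywhere
differentiability is the Radon–Nikodym property of Hilbert spaces. The rates under the range and
source conditions follow by testing optimality with a solution of Av = f, which bounds R. -/

/-! ### Almost everywhere differentiability of Lipschitz curves in Hilbert space -/

lemma hilbertBasis_index_countable {E ι : Type*} [NormedAddCommGroup E] [InnerProductSpace ℝ E]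
    [TopologicalSpace.SeparableSpace E] (b : HilbertBasis ι ℝ E) : Countable ι := by
  have hdist : ∀ i j, i ≠ j → 1 ≤ dist (b i) (b j) := by
    intro i j hij
    have h1 : ‖b i - b j‖ ^ 2 = 2 := by
      rw [@norm_sub_sq_real, b.orthonormal.1 i, b.orthonormal.1 j, b.orthonormal.2 hij]; norm_num
    rw [dist_eq_norm]
    nlinarith [norm_nonneg (b i - b j)]
  have hd : (Set.univ : Set ι).PairwiseDisjoint (fun i => Metric.ball (b i) (1 / 2)) := by
    intro i _ j _ hij
    apply Metric.ball_disjoint_ball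
    linarith [hdist i j hij]
  have := hd.countable_of_isOpen (fun i _ => Metric.isOpen_ball)
    (fun i _ => ⟨b i, Metric.mem_ball_self (by norm_num)⟩)
  exact Set.countable_univ_iff.mp this

lemma norm_sum_inner_smul_le {E ι : Type*} [NormedAddCommGroup E] [InnerProductSpace ℝ E]
    {v : ι → E} (hv : Orthonormal ℝ v) (s : Finset ι) (x : E) :
    ‖∑ i ∈ s, (inner ℝ (v i) x) • v i‖ ≤ ‖x‖ := by
  have h1 : ‖∑ i ∈ s, (inner ℝ (v i) x) • v i‖ ^ 2 = ∑ i ∈ s, ‖inner ℝ (v i) x‖ ^ 2 := by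
    rw [← real_inner_self_eq_norm_sq, hv.inner_sum]
    simp [sq]
  have h2 := hv.sum_inner_products_le x (s := s)
  rw [← h1] at h2
  exact (sq_le_sq₀ (norm_nonneg _) (norm_nonneg _)).mp h2

/-- Lipschitz curves in a separable Hilbert space are differentiable almost everywhere. -/
lemma lipschitzWith_ae_differentiableAt_of_separable {E : Type*} [NormedAddCommGroup E]
    [InnerProductSpace ℝ E] [CompleteSpace E] [TopologicalSpace.SeparableSpace E] {L : ℝ≥0}
    {f : ℝ → E} (hf : LipschitzWith L f) : ∀ᵐ t, DifferentiableAt ℝ f t := by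
  obtain ⟨w, b, -⟩ := exists_hilbertBasis ℝ E
  have hw : Countable w := hilbertBasis_index_countable b
  set φ : w → ℝ → ℝ := fun i t => inner ℝ (b i) (f t) with hφ
  have hφL : ∀ i, LipschitzWith L (φ i) := by
    intro i
    refine LipschitzWith.of_dist_le_mul fun x y => ?_
    rw [Real.dist_eq, hφ]
    simp only
    rw [← inner_sub_right]
    refine (abs_real_inner_le_norm _ _).trans ?_
    rw [b.orthonormal.1 i, one_mul, ← dist_eq_norm]
    exact hf.dist_le_mul x y
  have hae : ∀ᵐ t, ∀ i, DifferentiableAt ℝ (φ i) t :=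
    ae_all_iff.mpr fun i => (hφL i).ae_differentiableAt_real
  -- Finite coordinate truncations of f are again L-Lipschitz by Bessel, so their derivatives are
  -- bounded by L uniformly in s; this makes the coordinate derivatives square summable.
  have hbound : ∀ t, (∀ i, DifferentiableAt ℝ (φ i) t) → ∀ s : Finset w,
      ‖∑ i ∈ s, deriv (φ i) t • b i‖ ≤ L := by
    intro t ht s
    have hd : HasDerivAt (fun x => ∑ i ∈ s, φ i x • b i) (∑ i ∈ s, deriv (φ i) t • b i) t :=
      HasDerivAt.fun_sum fun i _ => (ht i).hasDerivAt.smul_const (b i)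
    have hl : LipschitzWith L (fun x => ∑ i ∈ s, φ i x • b i) := by
      refine LipschitzWith.of_dist_le_mul fun x y => ?_
      rw [dist_eq_norm, ← Finset.sum_sub_distrib]
      have : ∀ i ∈ s, φ i x • b i - φ i y • b i = (inner ℝ (b i) (f x - f y)) • b i := by
        intro i _
        rw [← sub_smul, inner_sub_right]
      rw [Finset.sum_congr rfl this]
      refine (norm_sum_inner_smul_le b.orthonormal s _).trans ?_
      rw [← dist_eq_norm]
      exact hf.dist_le_mul x y
    rw [← hd.deriv]
    exact norm_deriv_le_of_lipschitz hl
  have hsumm : ∀ t, (∀ i, DifferentiableAt ℝ (φ i) t) →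
      Memℓp (fun i => deriv (φ i) t) 2 := by
    intro t ht
    apply memℓp_gen' (C := (L : ℝ) ^ 2)
    intro s
    have h := hbound t ht s
    have h1 : ‖∑ i ∈ s, deriv (φ i) t • b i‖ ^ 2 = ∑ i ∈ s, ‖deriv (φ i) t‖ ^ 2 := by
      rw [← real_inner_self_eq_norm_sq, b.orthonormal.inner_sum]
      simp [sq]
    have h2 : ∑ i ∈ s, ‖deriv (φ i) t‖ ^ (2 : ℝ≥0∞).toReal = ∑ i ∈ s, ‖deriv (φ i) t‖ ^ 2 := by
      simp
    rw [h2, ← h1]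
    exact pow_le_pow_left₀ (norm_nonneg _) h 2
  classical
  -- The candidate derivative, assembled from the coordinate derivatives. The default value 0 can
  -- only be taken on a null set.
  set g : ℝ → E := fun t =>
    if h : Memℓp (fun i => deriv (φ i) t) 2 then b.repr.symm ⟨_, h⟩ else 0 with hg
  have hgsum : ∀ t, (∀ i, DifferentiableAt ℝ (φ i) t) →
      HasSum (fun i => deriv (φ i) t • b i) (g t) := by
    intro t ht
    simp only [hg, dif_pos (hsumm t ht)]
    exact b.hasSum_repr_symm ⟨_, hsumm t ht⟩
  have hginner : ∀ t, (∀ i, DifferentiableAt ℝ (φ i) t) → ∀ i,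
      inner ℝ (b i) (g t) = deriv (φ i) t := by
    intro t ht i
    simp only [hg, dif_pos (hsumm t ht)]
    rw [← b.repr_apply_apply, LinearIsometryEquiv.apply_symm_apply]
  have hgbound : ∀ᵐ t, ‖g t‖ ≤ L := by
    filter_upwards [hae] with t ht
    exact le_of_tendsto' (hgsum t ht).norm (hbound t ht)
  have hgmeas : AEStronglyMeasurable g volume := by
    refine aestronglyMeasurable_of_tendsto_ae (atTop : Filter (Finset w))
      (f := fun s t => ∑ i ∈ s, deriv (φ i) t • b i) (fun s => ?_) ?_
    · refine Finset.aestronglyMeasurable_fun_sum s fun i _ => ?_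
      exact ((measurable_deriv (φ i)).aestronglyMeasurable).smul_const (b i)
    · filter_upwards [hae] with t ht using hgsum t ht
  have hgloc : LocallyIntegrable g volume := by
    refine (locallyIntegrable_const (L : ℝ)).mono hgmeas ?_
    filter_upwards [hgbound] with t ht
    simpa using ht
  have hgint : ∀ x y, IntervalIntegrable g volume x y := fun x y =>
    intervalIntegrable_iff.mpr <|
      (hgloc.integrableOn_isCompact isCompact_uIcc).mono_set Set.uIoc_subset_uIcc
  -- Checked coordinatewise, where it is the fundamental theorem for absolutely continuous real
  -- functions. Lebesgue differentiation of the Bochner integral then gives the claim.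
  have hFTC : ∀ x, f x = f 0 + ∫ t in (0 : ℝ)..x, g t := by
    intro x
    apply b.repr.injective
    ext i
    rw [b.repr_apply_apply, b.repr_apply_apply, inner_add_right]
    have h0 : inner ℝ (b i) (∫ t in (0 : ℝ)..x, g t) = ∫ t in (0 : ℝ)..x, inner ℝ (b i) (g t) :=
      ((innerSL ℝ (b i)).intervalIntegral_comp_comm (hgint 0 x)).symm
    have h1 : ∫ t in (0 : ℝ)..x, inner ℝ (b i) (g t) = ∫ t in (0 : ℝ)..x, deriv (φ i) t := by
      apply intervalIntegral.integral_congr_ae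
      filter_upwards [hae] with t ht _ using hginner t ht i
    rw [h0, h1, ((hφL i).lipschitzOnWith).absolutelyContinuousOnInterval.integral_deriv_eq_sub]
    simp [hφ]
  filter_upwards [_root_.LocallyIntegrable.ae_hasDerivAt_integral hgloc] with t ht
  have hfe : f = fun x => f 0 + ∫ t in (0 : ℝ)..x, g t := funext hFTC
  rw [hfe]
  exact ((ht 0).const_add (f 0)).differentiableAt

/-- Lipschitz curves in a Hilbert space are differentiable almost everywhere. -/
lemma lipschitzWith_ae_differentiableAt {E : Type*} [NormedAddCommGroup E]
    [InnerProductSpace ℝ E] [CompleteSpace E] {L : ℝ≥0}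
    {f : ℝ → E} (hf : LipschitzWith L f) : ∀ᵐ t, DifferentiableAt ℝ f t := by
  -- The curve stays in the closed span of its range, which is separable because the curve is
  -- continuous.
  set K : Submodule ℝ E := (Submodule.span ℝ (Set.range f)).topologicalClosure with hK
  have hmem : ∀ t, f t ∈ K := fun t =>
    Submodule.le_topologicalClosure _ (Submodule.subset_span ⟨t, rfl⟩)
  have hsep : TopologicalSpace.IsSeparable (K : Set E) := by
    rw [hK, Submodule.topologicalClosure_coe]
    exact (TopologicalSpace.isSeparable_range hf.continuous).span.closure
  have : TopologicalSpace.SeparableSpace K := hsep.separableSpace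
  have : CompleteSpace K :=
    (Submodule.isClosed_topologicalClosure _).completeSpace_coe
  have hg : LipschitzWith L (fun t => (⟨f t, hmem t⟩ : K)) :=
    LipschitzWith.of_dist_le_mul fun x y => hf.dist_le_mul x y
  filter_upwards [lipschitzWith_ae_differentiableAt_of_separable hg] with t ht
  exact K.subtypeL.differentiableAt.comp t ht

/-- Curves in a Hilbert space that are Lipschitz on every `(δ, ∞)`, `δ > 0`, are differentiable
almost everywhere on `(0, ∞)`. -/
lemma ae_differentiableAt_of_lipschitzOn_Ioi {E : Type*} [NormedAddCommGroup E]
    [InnerProductSpace ℝ E] [CompleteSpace E] {f : ℝ → E}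
    (hf : ∀ δ > 0, ∃ L : ℝ≥0, LipschitzOnWith L f (Set.Ioi δ)) :
    ∀ δ > 0, ∀ᵐ t ∂(volume.restrict (Set.Ioi δ)), DifferentiableAt ℝ f t := by
  intro δ hδ
  obtain ⟨L, hL⟩ := hf (δ / 2) (by linarith)
  -- Freezing the curve to the left of δ makes it globally Lipschitz without changing it near any t
  -- > δ.
  have hg : LipschitzWith L (fun t => f (max t δ)) := by
    refine LipschitzWith.of_dist_le_mul fun x y => ?_
    have hx : ∀ z : ℝ, max z δ ∈ Set.Ioi (δ / 2) := fun z =>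
      lt_of_lt_of_le (by linarith) (le_max_right z δ)
    refine (hL.dist_le_mul _ (hx x) _ (hx y)).trans ?_
    gcongr
    rw [Real.dist_eq, Real.dist_eq]
    exact abs_max_sub_max_le_abs x y δ
  rw [ae_restrict_iff' measurableSet_Ioi]
  filter_upwards [lipschitzWith_ae_differentiableAt hg] with t ht htδ
  refine ht.congr_of_eventuallyEq ?_
  filter_upwards [Ioi_mem_nhds htδ] with x hx
  rw [max_eq_left (le_of_lt hx)]

/-! ### Comparison of two proximal points -/

section Estimates

variable {H : Type*} [NormedAddCommGroup H] [InnerProductSpace ℝ H]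

/-- Two points `y = prox_{σΦ}(f)`, `z = prox_{τΦ}(f)` with `Φ y = j` and `Φ z = k`. -/
lemma norm_sub_sq_le_of_prox {f y z : H} {σ τ j k : ℝ}
    (h1 : inner ℝ (f - y) (z - y) ≤ σ * (k - j)) (h2 : inner ℝ (f - z) (y - z) ≤ τ * (j - k)) :
    ‖z - y‖ ^ 2 ≤ (τ - σ) * (j - k) := by
  have h : inner ℝ (f - y) (z - y) + inner ℝ (f - z) (y - z) = ‖z - y‖ ^ 2 := by
    rw [← real_inner_self_eq_norm_sq, ← neg_sub z y, inner_neg_right, ← sub_eq_add_neg,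
      ← inner_sub_left]
    congr 1
    abel
  linarith

/-- In the combination τ·`h1` + σ·`h2` the values j and k cancel. What remains is σ‖z - y‖² ≤ -(τ -
σ)⟨f - y, z - y⟩, and Cauchy–Schwarz finishes. -/
lemma mul_norm_sub_le_of_prox {f y z : H} {σ τ j k : ℝ} (hσ : 0 ≤ σ) (hτ : σ ≤ τ)
    (h1 : inner ℝ (f - y) (z - y) ≤ σ * (k - j)) (h2 : inner ℝ (f - z) (y - z) ≤ τ * (j - k)) :
    σ * ‖z - y‖ ≤ (τ - σ) * ‖y - f‖ := by
  rcases eq_or_ne (z - y) 0 with h0 | h0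
  · rw [h0, norm_zero, mul_zero]
    exact mul_nonneg (by linarith) (norm_nonneg _)
  have hpos : 0 < ‖z - y‖ := norm_pos_iff.mpr h0
  have h : inner ℝ (f - z) (y - z) = ‖z - y‖ ^ 2 - inner ℝ (f - y) (z - y) := by
    rw [← real_inner_self_eq_norm_sq, ← neg_sub z y, inner_neg_right, ← inner_sub_left,
      ← inner_neg_left]
    congr 1
    abel
  have hcs : -(inner ℝ (f - y) (z - y)) ≤ ‖y - f‖ * ‖z - y‖ := by
    rw [← inner_neg_left, neg_sub]
    exact real_inner_le_norm _ _
  have h3 := mul_le_mul_of_nonneg_left h1 (hσ.trans hτ)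
  have h4 := mul_le_mul_of_nonneg_left h2 hσ
  rw [h] at h4
  have h5 := mul_le_mul_of_nonneg_left hcs (sub_nonneg.mpr hτ)
  have h6 : σ * ‖z - y‖ * ‖z - y‖ ≤ (τ - σ) * ‖y - f‖ * ‖z - y‖ := by nlinarith
  exact le_of_mul_le_mul_right h6 hpos

/-- With D = ‖z - y‖ and R = ‖y - f‖, σD ≤ (τ - σ)R reads σ(R + D) ≤ τR. Since k ≤ j and ‖z - f‖ ≤ R
+ D, the parameter τ is at most s j^(β-1) (R + D)^(2-α); cancelling powers leaves (R + D)^(α-1) /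
R^(α-1) ≤ s/t. -/
lemma norm_sub_le_of_one_lt {f y z : H} {α β s t j k : ℝ} (hα : 1 < α) (hα2 : α < 2)
    (hβ : 1 ≤ β) (ht : 0 < t) (hts : t ≤ s) (hk : 0 ≤ k) (hkj : k ≤ j) (hR : 0 < ‖y - f‖)
    (h1 : inner ℝ (f - y) (z - y) ≤ t * j ^ (β - 1) * ‖y - f‖ ^ (2 - α) * (k - j))
    (h2 : inner ℝ (f - z) (y - z) ≤ s * k ^ (β - 1) * ‖z - f‖ ^ (2 - α) * (j - k)) :
    ‖z - y‖ ≤ ‖y - f‖ * ((s / t) ^ (1 / (α - 1)) - 1) := by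
  have hs : 0 < s := ht.trans_le hts
  have hst : 1 ≤ s / t := (one_le_div ht).mpr hts
  rcases eq_or_ne (z - y) 0 with h0 | h0
  · rw [h0, norm_zero]
    refine mul_nonneg hR.le (sub_nonneg.mpr (Real.one_le_rpow hst ?_))
    exact div_nonneg zero_le_one (by linarith)
  set D := ‖z - y‖ with hD
  set R := ‖y - f‖ with hRdef
  have hDpos : 0 < D := norm_pos_iff.mpr h0
  have hsq := norm_sub_sq_le_of_prox h1 h2
  set σ := t * j ^ (β - 1) * R ^ (2 - α) with hσ
  set τ := s * k ^ (β - 1) * ‖z - f‖ ^ (2 - α) with hτ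
  -- The two points differ, so neither factor vanishes; with k ≤ j this forces k < j and σ ≤ τ.
  have hprod : 0 < (τ - σ) * (j - k) := lt_of_lt_of_le (by positivity) hsq
  have hkj' : 0 < j - k := by
    rcases (sub_nonneg.mpr hkj).lt_or_eq with h | h
    · exact h
    · rw [← h, mul_zero] at hprod; exact absurd hprod (lt_irrefl _)
  have hτσ : σ ≤ τ := by
    have := pos_of_mul_pos_left hprod hkj'.le
    linarith
  have hj : 0 < j := by linarith
  have hjp : 0 < j ^ (β - 1) := Real.rpow_pos_of_pos hj _
  have hRp : 0 < R ^ (2 - α) := Real.rpow_pos_of_pos hR _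
  have hσpos : 0 < σ := by positivity
  have h3 := mul_norm_sub_le_of_prox hσpos.le hτσ h1 h2
  have hτle : τ ≤ s * j ^ (β - 1) * (R + D) ^ (2 - α) := by
    have hz : ‖z - f‖ ≤ R + D := by
      have := norm_add_le (y - f) (z - y)
      rwa [show y - f + (z - y) = z - f by abel] at this
    have e1 : k ^ (β - 1) ≤ j ^ (β - 1) := Real.rpow_le_rpow hk hkj (by linarith)
    have e2 : ‖z - f‖ ^ (2 - α) ≤ (R + D) ^ (2 - α) :=
      Real.rpow_le_rpow (norm_nonneg _) hz (by linarith)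
    rw [hτ]
    gcongr
  have hRD : 0 < R + D := by positivity
  have h4 : σ * (R + D) ≤ s * j ^ (β - 1) * (R + D) ^ (2 - α) * R := by
    have := mul_le_mul_of_nonneg_right hτle hR.le
    rw [← hD, ← hRdef] at h3
    linarith
  have hA : (R + D) = (R + D) ^ (2 - α) * (R + D) ^ (α - 1) := by
    rw [← Real.rpow_add hRD]; norm_num
  have hB : R = R ^ (2 - α) * R ^ (α - 1) := by
    rw [← Real.rpow_add hR]; norm_num
  have hRDp : 0 < (R + D) ^ (2 - α) := Real.rpow_pos_of_pos hRD _
  have h5 : t * (R + D) ^ (α - 1) ≤ s * R ^ (α - 1) := by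
    have hc : 0 < j ^ (β - 1) * R ^ (2 - α) * (R + D) ^ (2 - α) := by positivity
    refine le_of_mul_le_mul_left ?_ hc
    calc j ^ (β - 1) * R ^ (2 - α) * (R + D) ^ (2 - α) * (t * (R + D) ^ (α - 1))
        = σ * ((R + D) ^ (2 - α) * (R + D) ^ (α - 1)) := by rw [hσ]; ring
      _ = σ * (R + D) := by rw [← hA]
      _ ≤ s * j ^ (β - 1) * (R + D) ^ (2 - α) * R := h4
      _ = s * j ^ (β - 1) * (R + D) ^ (2 - α) * (R ^ (2 - α) * R ^ (α - 1)) := by rw [← hB]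
      _ = _ := by ring
  have h6 : ((R + D) / R) ^ (α - 1) ≤ s / t := by
    rw [Real.div_rpow hRD.le hR.le, div_le_div_iff₀ (Real.rpow_pos_of_pos hR _) ht]
    linarith
  have h7 : (R + D) / R ≤ (s / t) ^ (1 / (α - 1)) := by
    have hq : 0 < α - 1 := by linarith
    rw [one_div]
    exact (Real.le_rpow_inv_iff_of_pos (by positivity) (by positivity) hq).mpr h6
  rw [div_le_iff₀ hR] at h7
  linarith

/-- Bernoulli's inequality needs an exponent at least 1; raising p to `max p 1` only decreases the
power, as r ≤ 1. -/
lemma one_sub_rpow_le {r p : ℝ} (hr : 0 < r) (hr1 : r ≤ 1) :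
    1 - r ^ p ≤ max p 1 * (1 - r) := by
  have h1 : r ^ max p 1 ≤ r ^ p := Real.rpow_le_rpow_of_exponent_ge hr hr1 (le_max_left _ _)
  have h2 := one_add_mul_self_le_rpow_one_add (s := r - 1) (by linarith) (le_max_right p 1)
  rw [show 1 + (r - 1) = r by ring] at h2
  linarith

/-- The monotonicity `h3` gives (k/j)^(β-1) ≥ t/s, hence j - k = O(s - t). Since τ - σ is at most a
multiple of (s - t) + D, the bound D² ≤ (τ - σ)(j - k) is a quadratic inequality that forces D = O(s
- t). -/
lemma norm_sub_le_of_eq_one {f y z : H} {β s t j k δ M N : ℝ}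
    (hβ : 1 < β) (hδ : 0 < δ) (hδt : δ ≤ t) (hts : t ≤ s) (hk : 0 ≤ k) (hkj : k ≤ j)
    (hM : t * j ^ β ≤ M) (hN : ‖z - f‖ ≤ N)
    (h1 : inner ℝ (f - y) (z - y) ≤ t * j ^ (β - 1) * ‖y - f‖ * (k - j))
    (h2 : inner ℝ (f - z) (y - z) ≤ s * k ^ (β - 1) * ‖z - f‖ * (j - k))
    (h3 : 0 ≤ (s * k ^ (β - 1) - t * j ^ (β - 1)) * (j - k)) :
    ‖z - y‖ ≤ (M * max (1 / (β - 1)) 1 * N / δ ^ 2 + M * max (1 / (β - 1)) 1 / δ + 1) *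
      (s - t) := by
  have ht : 0 < t := by linarith
  have hs : 0 < s := by linarith
  set κ := max (1 / (β - 1)) 1 with hκ
  have hκ1 : 1 ≤ κ := le_max_right _ _
  have hsq := norm_sub_sq_le_of_prox h1 h2
  set D := ‖z - y‖ with hD
  set x := s - t with hx
  have hx0 : 0 ≤ x := by linarith
  have hj0 : 0 ≤ j := hk.trans hkj
  have hN0 : 0 ≤ N := (norm_nonneg _).trans hN
  have hM0 : 0 ≤ M := le_trans (mul_nonneg ht.le (Real.rpow_nonneg hj0 _)) hM
  have hD0 : 0 ≤ D := norm_nonneg _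
  set K1 := M * κ * N / δ ^ 2 with hK1
  set K2 := M * κ / δ with hK2
  have hK10 : 0 ≤ K1 := by positivity
  have hK20 : 0 ≤ K2 := by positivity
  -- If D exceeded (K1 + K2 + 1)x, then x ≤ D, so the quadratic inequality would give D ≤ (K1 +
  -- K2)x, a contradiction.
  suffices hmain : D ^ 2 ≤ K1 * x ^ 2 + K2 * x * D by
    by_contra hlt
    push Not at hlt
    have hxD : x ≤ D := by nlinarith
    have hDpos : 0 < D := lt_of_le_of_lt (by positivity) hlt
    have e1 : K1 * x ^ 2 ≤ K1 * x * D := by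
      rw [sq, ← mul_assoc]
      exact mul_le_mul_of_nonneg_left hxD (by positivity)
    have e2 : D * D ≤ ((K1 + K2) * x) * D := by nlinarith
    have e3 := le_of_mul_le_mul_right e2 hDpos
    nlinarith
  rcases hkj.eq_or_lt with hjk | hjk
  · rw [hjk, sub_self, mul_zero] at hsq
    exact hsq.trans (by positivity)
  have hj : 0 < j := by linarith
  have hjp : 0 < j ^ (β - 1) := Real.rpow_pos_of_pos hj _
  have h4 : t * j ^ (β - 1) ≤ s * k ^ (β - 1) := by
    have := nonneg_of_mul_nonneg_left h3 (by linarith : 0 < j - k)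
    linarith
  have hβ1 : 0 < β - 1 := by linarith
  have h5 : j - k ≤ j * (κ * (x / t)) := by
    have e1 : t / s ≤ (k / j) ^ (β - 1) := by
      rw [Real.div_rpow hk hj.le, div_le_div_iff₀ hs hjp]
      linarith
    have e2 : (t / s) ^ (1 / (β - 1)) ≤ k / j := by
      rw [one_div]
      exact (Real.rpow_inv_le_iff_of_pos (by positivity) (by positivity) hβ1).mpr e1
    have e3 := one_sub_rpow_le (r := t / s) (p := 1 / (β - 1)) (by positivity)
      ((div_le_one hs).mpr hts)
    have e4 : 1 - t / s ≤ x / t := by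
      rw [hx, one_sub_div hs.ne']
      exact div_le_div_of_nonneg_left hx0 ht hts
    have e5 : 1 - k / j ≤ κ * (x / t) :=
      calc 1 - k / j ≤ κ * (1 - t / s) := by linarith
        _ ≤ κ * (x / t) := by gcongr
    calc j - k = j * (1 - k / j) := by field_simp
      _ ≤ _ := by gcongr
  have hz : ‖z - f‖ ≤ ‖y - f‖ + D := by
    have := norm_add_le (y - f) (z - y)
    rwa [show y - f + (z - y) = z - f by abel] at this
  have h6 : s * k ^ (β - 1) * ‖z - f‖ - t * j ^ (β - 1) * ‖y - f‖ ≤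
      j ^ (β - 1) * (x * N + t * D) := by
    have e1 : k ^ (β - 1) ≤ j ^ (β - 1) := Real.rpow_le_rpow hk hkj hβ1.le
    have e2 : s * k ^ (β - 1) * ‖z - f‖ ≤ s * j ^ (β - 1) * ‖z - f‖ := by gcongr
    have e3 : s * ‖z - f‖ - t * ‖y - f‖ ≤ x * N + t * D := by
      have e4 : x * ‖z - f‖ ≤ x * N := by gcongr
      have e5 : t * ‖z - f‖ ≤ t * (‖y - f‖ + D) := by gcongr
      rw [hx] at e4 ⊢
      linarith
    have := mul_le_mul_of_nonneg_left e3 hjp.le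
    linarith
  have hjβ : j ^ (β - 1) * j = j ^ β := by
    rw [← Real.rpow_add_one hj.ne']; norm_num
  have hjM : j ^ β ≤ M / t := by
    rw [le_div_iff₀ ht]; linarith
  calc D ^ 2 ≤ _ := hsq
    _ ≤ (j ^ (β - 1) * (x * N + t * D)) * (j - k) :=
        mul_le_mul_of_nonneg_right h6 (by linarith)
    _ ≤ (j ^ (β - 1) * (x * N + t * D)) * (j * (κ * (x / t))) :=
        mul_le_mul_of_nonneg_left h5 (by positivity)
    _ = j ^ β * ((x * N + t * D) * (κ * (x / t))) := by rw [← hjβ]; ring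
    _ ≤ M / t * ((x * N + t * D) * (κ * (x / t))) :=
        mul_le_mul_of_nonneg_right hjM (by positivity)
    _ = M * κ * N / t ^ 2 * x ^ 2 + M * κ / t * x * D := by field_simp
    _ ≤ K1 * x ^ 2 + K2 * x * D := by
        rw [hK1, hK2]
        gcongr

end Estimates

/-- A function with nonnegative increments to the right of `0` has nonnegative derivative. -/
lemma deriv_nonneg_of_forall_le {g : ℝ → ℝ} {g' : ℝ} (hg : HasDerivAt g g' 0)
    (h : ∀ ε ∈ Set.Icc (0 : ℝ) 1, g 0 ≤ g ε) : 0 ≤ g' := by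
  have h1 := (hasDerivAt_iff_tendsto_slope.mp hg).mono_left
    (nhdsWithin_mono 0 (fun x (hx : x ∈ Set.Ioi (0 : ℝ)) => ne_of_gt hx))
  refine ge_of_tendsto h1 ?_
  filter_upwards [Ioo_mem_nhdsGT (zero_lt_one : (0 : ℝ) < 1)] with ε hε
  rw [slope_def_field]
  exact div_nonneg (sub_nonneg.mpr (h ε ⟨hε.1.le, hε.2.le⟩)) (by linarith [hε.1])

/-! ### Coercivity and existence of minimizers -/

section Regularizer

open Filter

variable {Y : Type*} [NormedAddCommGroup Y] [NormedSpace ℝ Y]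
  {H : Type*} [NormedAddCommGroup H] [InnerProductSpace ℝ H]
  {A : StrongDual ℝ Y →L[ℝ] H} {J : StrongDual ℝ Y → ℝ≥0∞}

lemma IsRegularizer.map_zero (hJ : IsRegularizer J) : J 0 = 0 := by
  simpa using hJ.homogeneous 0 0

lemma IsRegularizer.convex_dom (hJ : IsRegularizer J) {u v : StrongDual ℝ Y} (hu : J u ≠ ∞)
    (hv : J v ≠ ∞) {a b : ℝ} (ha : 0 ≤ a) (hb : 0 ≤ b) (hab : a + b = 1) :
    J (a • u + b • v) ≠ ∞ ∧
      (J (a • u + b • v)).toReal ≤ a * (J u).toReal + b * (J v).toReal := by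
  have h := hJ.convex u v a b ha hb hab
  have h1 : ENNReal.ofReal a * J u ≠ ∞ := ENNReal.mul_ne_top ENNReal.ofReal_ne_top hu
  have h2 : ENNReal.ofReal b * J v ≠ ∞ := ENNReal.mul_ne_top ENNReal.ofReal_ne_top hv
  have h3 : ENNReal.ofReal a * J u + ENNReal.ofReal b * J v ≠ ∞ := ENNReal.add_ne_top.mpr ⟨h1, h2⟩
  refine ⟨ne_top_of_le_ne_top h3 h, ?_⟩
  have h4 := ENNReal.toReal_mono h3 h
  rwa [ENNReal.toReal_add h1 h2, ENNReal.toReal_mul, ENNReal.toReal_mul, ENNReal.toReal_ofReal ha,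
    ENNReal.toReal_ofReal hb] at h4

/-- The null space as a submodule. -/
def nullSubmodule (hJ : IsRegularizer J) : Submodule ℝ (StrongDual ℝ Y) where
  carrier := nullSpace J
  zero_mem' := hJ.map_zero
  smul_mem' c u hu := by
    have hu' : J u = 0 := hu
    change J (c • u) = 0
    rw [hJ.homogeneous, hu', mul_zero]
  add_mem' {u v} hu hv := by
    have hu' : J u = 0 := hu
    have hv' : J v = 0 := hv
    change J (u + v) = 0
    -- The sum u + v is the midpoint of 2u and 2v, both in the null space by homogeneity.
    have h := hJ.convex ((2 : ℝ) • u) ((2 : ℝ) • v) (1 / 2) (1 / 2) (by norm_num) (by norm_num)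
      (by norm_num)
    rw [hJ.homogeneous, hJ.homogeneous, hu', hv', smul_smul, smul_smul] at h
    norm_num at h
    exact h

lemma isClosed_nullSpace (hJ : IsRegularizer J) : IsClosed (nullSpace J) := by
  have h1 := hJ.weakStar_lsc.isClosed_preimage 0
  have h2 := h1.preimage (NormedSpace.Dual.toWeakDual_continuous (𝕜 := ℝ) (E := Y))
  convert h2 using 1
  ext u
  simp [nullSpace]

lemma exists_norm_sub_le_of_isComplete (K : Submodule ℝ H) (hK : IsComplete (K : Set H)) (h : H) :
    ∃ v ∈ K, ∀ w ∈ K, ‖v - h‖ ≤ ‖w - h‖ := by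
  obtain ⟨v, hv, hmin⟩ := Submodule.exists_norm_eq_iInf_of_complete_subspace K hK h
  refine ⟨v, hv, fun w hw => ?_⟩
  rw [norm_sub_rev, norm_sub_rev w, hmin]
  exact ciInf_le (f := fun y : K => ‖h - y‖)
    ⟨0, by rintro _ ⟨y, rfl⟩; exact norm_nonneg _⟩ ⟨w, hw⟩

lemma isComplete_map_of_antilipschitz {X : Type*} [NormedAddCommGroup X] [NormedSpace ℝ X]
    [CompleteSpace X] (T : X →L[ℝ] H) (N : Submodule ℝ X) (hN : IsClosed (N : Set X)) {c : ℝ}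
    (hc : 0 < c) (hb : ∀ u ∈ N, c * ‖u‖ ≤ ‖T u‖) :
    IsComplete (N.map (T : X →ₗ[ℝ] H) : Set H) := by
  have : CompleteSpace N := hN.completeSpace_coe
  have hanti : AntilipschitzWith (Real.toNNReal c⁻¹) (T.comp N.subtypeL) := by
    refine AddMonoidHomClass.antilipschitz_of_bound (T.comp N.subtypeL) fun x => ?_
    rw [Real.coe_toNNReal _ (by positivity), inv_mul_eq_div, le_div_iff₀ hc, mul_comm]
    exact hb x x.2
  have h := hanti.isComplete_range (T.comp N.subtypeL).uniformContinuous
  have he : (N.map (T : X →ₗ[ℝ] H) : Set H) = Set.range (T.comp N.subtypeL) := by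
    ext y
    simp
  rwa [he]

/-- The Poincaré inequality speaks only of points that are projections, so one must be exhibited.
The null space is closed and A is bounded below on it, so its image is complete and has a nearest
point to h. -/
lemma exists_isAProj (hJ : IsRegularizer J) (hA : NormEquivOnNull A J) (h : H) :
    ∃ w, IsAProj A J h w := by
  obtain ⟨c, hc, C, hC, hb⟩ := hA
  obtain ⟨_, ⟨w, hw, rfl⟩, hmin⟩ := exists_norm_sub_le_of_isComplete _
    (isComplete_map_of_antilipschitz A (nullSubmodule hJ) (isClosed_nullSpace hJ) hc
      fun u hu => (hb u hu).1) h
  exact ⟨w, hw, fun x hx => hmin (A x) ⟨x, hx, rfl⟩⟩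

/-- Coercivity: `‖A u‖` and `J u` control the norm of `u`. -/
lemma exists_norm_le (hJ : IsRegularizer J) (hA : NormEquivOnNull A J)
    (hP : PoincareIneq A J) :
    ∃ K : ℝ, 0 ≤ K ∧ ∀ u, J u ≠ ∞ → ‖u‖ ≤ K * (‖A u‖ + (J u).toReal) := by
  have hproj := exists_isAProj hJ hA
  obtain ⟨c, hc, C', -, hb⟩ := hA
  obtain ⟨C, hC, hP⟩ := hP
  refine ⟨2 / c + C, by positivity, fun u hu => ?_⟩
  obtain ⟨w, hw⟩ := hproj (A u)
  have h1 : ‖u - w‖ ≤ C * (J u).toReal := by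
    have := ENNReal.toReal_mono (ENNReal.mul_ne_top ENNReal.ofReal_ne_top hu) (hP u w hw)
    rwa [ENNReal.toReal_ofReal (norm_nonneg _), ENNReal.toReal_mul,
      ENNReal.toReal_ofReal hC.le] at this
  have h2 : ‖A w - A u‖ ≤ ‖A u‖ := by
    have h0 : (0 : StrongDual ℝ Y) ∈ nullSpace J := hJ.map_zero
    have := hw.2 h0
    simpa using this
  have h3 : ‖A w‖ ≤ 2 * ‖A u‖ := by
    have := norm_add_le (A w - A u) (A u)
    rw [sub_add_cancel] at this
    linarith
  have h4 : ‖w‖ ≤ 2 / c * ‖A u‖ := by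
    rw [div_mul_eq_mul_div, le_div_iff₀ hc]
    linarith [(hb w hw.1).1]
  have h5 : ‖u‖ ≤ ‖u - w‖ + ‖w‖ := by
    simpa using norm_add_le (u - w) w
  have h6 : 0 ≤ C * ‖A u‖ := by positivity
  have h7 : 0 ≤ 2 / c * (J u).toReal := by positivity
  linarith

/-- The energy as a real number (meaningful on `dom J`). -/
noncomputable def realEnergy (A : StrongDual ℝ Y →L[ℝ] H) (J : StrongDual ℝ Y → ℝ≥0∞) (f : H) (α β t : ℝ)
    (u : StrongDual ℝ Y) : ℝ :=
  1 / α * ‖A u - f‖ ^ α + t / β * (J u).toReal ^ β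

variable {f : H} {α β t : ℝ}

lemma realEnergy_nonneg (hα : 1 ≤ α) (hβ : 1 ≤ β) (ht : 0 < t) (u : StrongDual ℝ Y) :
    0 ≤ realEnergy A J f α β t u := by
  unfold realEnergy
  positivity

lemma energy_eq_ofReal (hα : 1 ≤ α) (hβ : 1 ≤ β) (ht : 0 < t) {u : StrongDual ℝ Y}
    (hu : J u ≠ ∞) : energy A J f α β t u = ENNReal.ofReal (realEnergy A J f α β t u) := by
  unfold energy realEnergy
  have hα0 : 0 < α := by linarith
  have hβ0 : 0 < β := by linarith
  rw [ENNReal.ofReal_add (by positivity) (by positivity), ENNReal.ofReal_mul (p := t / β)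
    (by positivity), ← ENNReal.ofReal_rpow_of_nonneg ENNReal.toReal_nonneg hβ0.le,
    ENNReal.ofReal_toReal hu]

lemma energy_eq_top (hβ : 1 ≤ β) (ht : 0 < t) {u : StrongDual ℝ Y}
    (hu : J u = ∞) : energy A J f α β t u = ∞ := by
  unfold energy
  have hβ0 : 0 < β := by linarith
  rw [hu, ENNReal.top_rpow_of_pos hβ0, ENNReal.mul_top, add_top]
  simp only [ne_eq, ENNReal.ofReal_eq_zero, not_le]
  positivity

/-- `u ∈ dom J` minimizes the real energy over `dom J`. -/
def IsMinimizer (A : StrongDual ℝ Y →L[ℝ] H) (J : StrongDual ℝ Y → ℝ≥0∞) (f : H) (α β t : ℝ)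
    (u : StrongDual ℝ Y) : Prop :=
  J u ≠ ∞ ∧ ∀ v, J v ≠ ∞ → realEnergy A J f α β t u ≤ realEnergy A J f α β t v

lemma isMinOn_energy_iff (hJ : IsRegularizer J) (hα : 1 ≤ α) (hβ : 1 ≤ β) (ht : 0 < t)
    (u : StrongDual ℝ Y) :
    IsMinOn (energy A J f α β t) Set.univ u ↔ IsMinimizer A J f α β t u := by
  rw [isMinOn_univ_iff]
  constructor
  · intro h
    have hu : J u ≠ ∞ := by
      intro hu
      have h0 := h 0
      have hz : J 0 ≠ ∞ := by rw [hJ.map_zero]; exact ENNReal.zero_ne_top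
      rw [energy_eq_top hβ ht hu, energy_eq_ofReal hα hβ ht hz, top_le_iff] at h0
      exact ENNReal.ofReal_ne_top h0
    refine ⟨hu, fun v hv => ?_⟩
    have := h v
    rwa [energy_eq_ofReal hα hβ ht hu, energy_eq_ofReal hα hβ ht hv,
      ENNReal.ofReal_le_ofReal_iff (realEnergy_nonneg hα hβ ht v)] at this
  · rintro ⟨hu, h⟩ v
    by_cases hv : J v = ∞
    · rw [energy_eq_top hβ ht hv]; exact le_top
    · rw [energy_eq_ofReal hα hβ ht hu, energy_eq_ofReal hα hβ ht hv]
      exact ENNReal.ofReal_le_ofReal (h v hv)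

/-- Weak lower semicontinuity of the norm: testing against the limit itself and Cauchy–Schwarz give
‖z‖² ≤ ‖z‖ a. -/
lemma norm_le_of_tendsto_weak {y : ℕ → H} {z : H} {a : ℝ}
    (hy : Tendsto (fun n => inner ℝ z (y n)) atTop (𝓝 (inner ℝ z z)))
    (ha : Tendsto (fun n => ‖y n‖) atTop (𝓝 a)) : ‖z‖ ≤ a := by
  have h0 : 0 ≤ a := ge_of_tendsto' ha fun n => norm_nonneg _
  have h1 : inner ℝ z z ≤ ‖z‖ * a :=
    le_of_tendsto_of_tendsto' hy (ha.const_mul ‖z‖) fun n => real_inner_le_norm _ _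
  rw [real_inner_self_eq_norm_sq] at h1
  rcases (norm_nonneg z).eq_or_lt with h | h
  · rw [← h]; exact h0
  · nlinarith

lemma toReal_le_of_tendsto_weakStar (hJ : IsRegularizer J) {u : ℕ → StrongDual ℝ Y}
    {v : StrongDual ℝ Y} {b : ℝ}
    (hu : Tendsto (fun n => StrongDual.toWeakDual (u n)) atTop (𝓝 (StrongDual.toWeakDual v)))
    (hdom : ∀ n, J (u n) ≠ ∞) (hb : Tendsto (fun n => (J (u n)).toReal) atTop (𝓝 b)) :
    J v ≠ ∞ ∧ (J v).toReal ≤ b := by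
  have h0 : 0 ≤ b := ge_of_tendsto' hb fun n => ENNReal.toReal_nonneg
  have hb' : Tendsto (fun n => J (u n)) atTop (𝓝 (ENNReal.ofReal b)) := by
    have := ENNReal.tendsto_ofReal hb
    simpa [ENNReal.ofReal_toReal (hdom _)] using this
  have hle : J v ≤ ENNReal.ofReal b := by
    by_contra hlt
    push Not at hlt
    obtain ⟨c, hc1, hc2⟩ := exists_between hlt
    have h1 := hu.eventually (hJ.weakStar_lsc (StrongDual.toWeakDual v) c hc2)
    have h2 := hb'.eventually (gt_mem_nhds hc1)
    obtain ⟨n, hn1, hn2⟩ := (h1.and h2).exists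
    exact absurd (hn1.trans hn2) (lt_irrefl _)
  refine ⟨ne_top_of_le_ne_top ENNReal.ofReal_ne_top hle, ?_⟩
  have := ENNReal.toReal_mono ENNReal.ofReal_ne_top hle
  rwa [ENNReal.toReal_ofReal h0] at this

lemma exists_isMinimizer [TopologicalSpace.SeparableSpace Y]
    (hJ : IsRegularizer J) (hA : NormEquivOnNull A J)
    (hP : PoincareIneq A J) (hW : WeakStarToWeak A) (f : H) (hα : 1 ≤ α) (hβ : 1 ≤ β)
    (ht : 0 < t) : ∃ u, IsMinimizer A J f α β t u := by
  obtain ⟨K, hK, hcoer⟩ := exists_norm_le hJ hA hP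
  have hα0 : 0 < α := by linarith
  have hβ0 : 0 < β := by linarith
  set e := realEnergy A J f α β t with he
  set S := e '' {u | J u ≠ ∞} with hS
  have hne : S.Nonempty :=
    ⟨e 0, 0, by simp [hJ.map_zero], rfl⟩
  have hbdd : BddBelow S := ⟨0, by rintro _ ⟨u, -, rfl⟩; exact realEnergy_nonneg hα hβ ht u⟩
  obtain ⟨x, -, hx, hxS⟩ := exists_seq_tendsto_sInf hne hbdd
  choose u hu hux using hxS
  obtain rfl : (fun n => e (u n)) = x := funext hux
  obtain ⟨M, hM⟩ := hx.bddAbove_range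
  have hM' : ∀ n, e (u n) ≤ M := fun n => hM ⟨n, rfl⟩
  have hM0 : 0 ≤ M := (realEnergy_nonneg hα hβ ht (u 0)).trans (hM' 0)
  have hbR : ∀ n, ‖A (u n) - f‖ ≤ (α * M) ^ α⁻¹ := by
    intro n
    rw [Real.le_rpow_inv_iff_of_pos (norm_nonneg _) (by positivity) hα0]
    have h1 : 1 / α * ‖A (u n) - f‖ ^ α ≤ M := by
      refine le_trans ?_ (hM' n)
      rw [he, realEnergy]
      have : 0 ≤ t / β * (J (u n)).toReal ^ β := by positivity
      linarith
    rwa [one_div, inv_mul_le_iff₀ hα0] at h1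
  have hbJ : ∀ n, (J (u n)).toReal ≤ (β / t * M) ^ β⁻¹ := by
    intro n
    rw [Real.le_rpow_inv_iff_of_pos ENNReal.toReal_nonneg (by positivity) hβ0]
    have h1 : t / β * (J (u n)).toReal ^ β ≤ M := by
      refine le_trans ?_ (hM' n)
      rw [he, realEnergy]
      have : 0 ≤ 1 / α * ‖A (u n) - f‖ ^ α := by positivity
      linarith
    rw [← inv_div, inv_mul_eq_div, le_div_iff₀ (by positivity)]
    linarith
  set r := K * ((α * M) ^ α⁻¹ + ‖f‖ + (β / t * M) ^ β⁻¹) with hr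
  have hbu : ∀ n, ‖u n‖ ≤ r := by
    intro n
    refine (hcoer (u n) (hu n)).trans ?_
    rw [hr]
    have h1 : ‖A (u n)‖ ≤ ‖A (u n) - f‖ + ‖f‖ := by
      simpa using norm_add_le (A (u n) - f) f
    have h2 := hbR n
    have h3 := hbJ n
    gcongr
    linarith
  -- Separability of Y makes balls weak-* sequentially compact. Two further extractions make
  -- residuals and values of J converge separately, so the infimum equals the energy expression at
  -- their limits a and b.
  obtain ⟨v, -, φ, hφ, hv⟩ := WeakDual.isSeqCompact_closedBall ℝ Y 0 r
    (x := fun n => StrongDual.toWeakDual (u n)) (fun n => by simpa using hbu n)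
  obtain ⟨a, -, ψ, hψ, ha⟩ := tendsto_subseq_of_bounded
    (s := Set.Icc 0 ((α * M) ^ α⁻¹)) (Metric.isBounded_Icc _ _)
    (x := fun n => ‖A (u (φ n)) - f‖) (fun n => ⟨norm_nonneg _, hbR _⟩)
  obtain ⟨b, -, θ, hθ, hb⟩ := tendsto_subseq_of_bounded
    (s := Set.Icc 0 ((β / t * M) ^ β⁻¹)) (Metric.isBounded_Icc _ _)
    (x := fun n => (J (u (φ (ψ n)))).toReal) (fun n => ⟨ENNReal.toReal_nonneg, hbJ _⟩)
  set v' : StrongDual ℝ Y := WeakDual.toStrongDual v with hv'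
  set w : ℕ → StrongDual ℝ Y := fun n => u (φ (ψ (θ n))) with hw
  have hwv : Tendsto (fun n => StrongDual.toWeakDual (w n)) atTop
      (𝓝 (StrongDual.toWeakDual v')) :=
    hv.comp (hψ.tendsto_atTop.comp hθ.tendsto_atTop)
  have hwa : Tendsto (fun n => ‖A (w n) - f‖) atTop (𝓝 a) := ha.comp hθ.tendsto_atTop
  have hwb : Tendsto (fun n => (J (w n)).toReal) atTop (𝓝 b) := hb
  have hwe : Tendsto (fun n => e (w n)) atTop (𝓝 (sInf S)) :=
    hx.comp (hφ.tendsto_atTop.comp (hψ.tendsto_atTop.comp hθ.tendsto_atTop))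
  have hAw : ∀ z : H, Tendsto (fun n => inner ℝ z (A (w n))) atTop (𝓝 (inner ℝ z (A v'))) := by
    intro z
    have h1 := hW w v' hwv
    have h2 := (WeakBilin.eval_continuous (topDualPairing ℝ H).flip (innerSL ℝ z)).tendsto
      (toWeakSpace ℝ H (A v'))
    exact h2.comp h1
  obtain ⟨hvdom, hvb⟩ := toReal_le_of_tendsto_weakStar hJ hwv (fun n => hu _) hwb
  have hva : ‖A v' - f‖ ≤ a := by
    refine norm_le_of_tendsto_weak (y := fun n => A (w n) - f) ?_ hwa
    simp only [inner_sub_right _ _ f]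
    exact (hAw (A v' - f)).sub_const _
  have hlim : Tendsto (fun n => e (w n)) atTop (𝓝 (1 / α * a ^ α + t / β * b ^ β)) := by
    refine Tendsto.add ?_ ?_
    · exact (hwa.rpow_const (Or.inr hα0.le)).const_mul _
    · exact (hwb.rpow_const (Or.inr hβ0.le)).const_mul _
  have heq := tendsto_nhds_unique hwe hlim
  refine ⟨v', hvdom, fun z hz => ?_⟩
  have h1 : sInf S ≤ e z := csInf_le hbdd ⟨z, hz, rfl⟩
  refine le_trans ?_ h1
  rw [heq, realEnergy]
  gcongr

end Regularizer

/-! ### Optimality conditions and a priori bounds -/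

section Minimizers

open Filter

variable {Y : Type*} [NormedAddCommGroup Y] [NormedSpace ℝ Y]
  {H : Type*} [NormedAddCommGroup H] [InnerProductSpace ℝ H]
  {A : StrongDual ℝ Y →L[ℝ] H} {J : StrongDual ℝ Y → ℝ≥0∞} {f : H} {α β s t : ℝ}
  {u v : StrongDual ℝ Y}

/-- Convexity replaces J along the segment by its chord. The resulting majorant touches the energy
at ε = 0 and can be differentiated there (away from zero residual if α = 1), although J itself need
not be differentiable. -/
lemma IsMinimizer.realEnergy_le_segment (hJ : IsRegularizer J) (hβ : 1 ≤ β) (ht : 0 < t)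
    (hu : IsMinimizer A J f α β t u) (hv : J v ≠ ∞) {ε : ℝ} (hε : ε ∈ Set.Icc (0 : ℝ) 1) :
    realEnergy A J f α β t u ≤ 1 / α * ‖(A u - f) + ε • (A v - A u)‖ ^ α +
      t / β * ((J u).toReal + ε * ((J v).toReal - (J u).toReal)) ^ β := by
  obtain ⟨h1, h2⟩ := hJ.convex_dom hu.1 hv (sub_nonneg.mpr hε.2) hε.1 (by ring)
  refine (hu.2 _ h1).trans ?_
  unfold realEnergy
  have h3 : A ((1 - ε) • u + ε • v) - f = (A u - f) + ε • (A v - A u) := by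
    rw [map_add, map_smul, map_smul]
    module
  rw [h3]
  have h4 : (1 - ε) * (J u).toReal + ε * (J v).toReal =
      (J u).toReal + ε * ((J v).toReal - (J u).toReal) := by ring
  rw [h4] at h2
  have h5 : (J ((1 - ε) • u + ε • v)).toReal ^ β ≤
      ((J u).toReal + ε * ((J v).toReal - (J u).toReal)) ^ β :=
    Real.rpow_le_rpow ENNReal.toReal_nonneg h2 (by linarith)
  have h6 : 0 ≤ t / β := by positivity
  have := mul_le_mul_of_nonneg_left h5 h6
  linarith

lemma hasDerivAt_rpow_line (hβ : 1 ≤ β) (t j d : ℝ) :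
    HasDerivAt (fun ε : ℝ => t / β * (j + ε * d) ^ β) (t * j ^ (β - 1) * d) 0 := by
  have h1 : HasDerivAt (fun ε : ℝ => j + ε * d) d 0 := by
    simpa using ((hasDerivAt_id (0 : ℝ)).mul_const d).const_add j
  have h2 := (h1.rpow_const (p := β) (Or.inr hβ)).const_mul (t / β)
  refine h2.congr_deriv ?_
  have : β ≠ 0 := by linarith
  simp only [zero_mul, add_zero]
  field_simp

lemma hasDerivAt_norm_rpow_line (hα : 1 ≤ α) {x d : H} (hx : x ≠ 0) :
    HasDerivAt (fun ε : ℝ => 1 / α * ‖x + ε • d‖ ^ α) (‖x‖ ^ (α - 2) * inner ℝ x d) 0 := by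
  have h1 : HasDerivAt (fun ε : ℝ => x + ε • d) d 0 := by
    simpa using ((hasDerivAt_id (0 : ℝ)).smul_const d).const_add x
  have hx0 : 0 < ‖x‖ := norm_pos_iff.mpr hx
  have h2 := (h1.norm_sq.rpow_const (p := α / 2) (Or.inl (by simpa using hx))).const_mul (1 / α)
  have h3 : ∀ (y : ℝ) (p : ℝ), 0 ≤ y → (y ^ 2) ^ p = y ^ (2 * p) := by
    intro y p hy
    rw [← Real.rpow_natCast, ← Real.rpow_mul hy]
    norm_num
  have h4 : (fun ε : ℝ => 1 / α * ‖x + ε • d‖ ^ α) =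
      fun ε : ℝ => 1 / α * (‖x + ε • d‖ ^ 2) ^ (α / 2) := by
    ext ε
    rw [h3 _ _ (norm_nonneg _), mul_div_cancel₀ _ (two_ne_zero)]
  rw [h4]
  refine h2.congr_deriv ?_
  simp only [zero_smul, add_zero]
  rw [h3 _ _ (norm_nonneg _), show 2 * (α / 2 - 1) = α - 2 by ring]
  have : α ≠ 0 := by linarith
  field_simp

/-- Optimality condition: `A u` is a proximal point with parameter
`t J(u) ^ (β - 1) ‖A u - f‖ ^ (2 - α)`. -/
lemma IsMinimizer.inner_le (hJ : IsRegularizer J) (hα : 1 ≤ α) (hα2 : α < 2) (hβ : 1 ≤ β)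
    (ht : 0 < t) (hu : IsMinimizer A J f α β t u) (hv : J v ≠ ∞) :
    inner ℝ (f - A u) (A v - A u) ≤
      t * (J u).toReal ^ (β - 1) * ‖A u - f‖ ^ (2 - α) * ((J v).toReal - (J u).toReal) := by
  -- At zero residual both sides vanish, since 2 - α > 0.
  rcases eq_or_ne (A u - f) 0 with h0 | h0
  · rw [← neg_sub (A u) f, h0, norm_zero, Real.zero_rpow (by linarith)]
    simp
  have hR : 0 < ‖A u - f‖ := norm_pos_iff.mpr h0
  have h1 := (hasDerivAt_norm_rpow_line (d := A v - A u) hα h0).add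
    (hasDerivAt_rpow_line hβ t (J u).toReal ((J v).toReal - (J u).toReal))
  have h2 := deriv_nonneg_of_forall_le h1 (fun ε hε => by
    have := hu.realEnergy_le_segment hJ hβ ht hv hε
    simpa [realEnergy] using this)
  have h3 : ‖A u - f‖ ^ (2 - α) * ‖A u - f‖ ^ (α - 2) = 1 := by
    rw [← Real.rpow_add hR]; norm_num
  have h4 := mul_nonneg (Real.rpow_nonneg hR.le (2 - α)) h2
  rw [mul_add, ← mul_assoc, h3, one_mul] at h4
  rw [← neg_sub (A u) f, inner_neg_left]
  linarith

/-- For `α = 1`, a minimizer of the energy also minimizes its linearization in `J`. -/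
lemma IsMinimizer.linearized_le (hJ : IsRegularizer J) (hβ : 1 ≤ β)
    (ht : 0 < t) (hu : IsMinimizer A J f 1 β t u) (hv : J v ≠ ∞) :
    0 ≤ ‖A v - f‖ - ‖A u - f‖ + t * (J u).toReal ^ (β - 1) * ((J v).toReal - (J u).toReal) := by
  have h0 : HasDerivAt (fun ε : ℝ => ‖A u - f‖ + ε * (‖A v - f‖ - ‖A u - f‖))
      (‖A v - f‖ - ‖A u - f‖) 0 := by
    simpa using ((hasDerivAt_id (0 : ℝ)).mul_const (‖A v - f‖ - ‖A u - f‖)).const_add ‖A u - f‖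
  have h1 := h0.add (hasDerivAt_rpow_line hβ t (J u).toReal ((J v).toReal - (J u).toReal))
  refine deriv_nonneg_of_forall_le h1 (fun ε hε => ?_)
  have h2 := hu.realEnergy_le_segment hJ hβ ht hv hε
  -- The norm too is replaced by its chord, so zero residual needs no separate treatment.
  have h3 : ‖(A u - f) + ε • (A v - A u)‖ ≤ ‖A u - f‖ + ε * (‖A v - f‖ - ‖A u - f‖) := by
    have e1 : (A u - f) + ε • (A v - A u) = (1 - ε) • (A u - f) + ε • (A v - f) := by module
    rw [e1]
    refine (norm_add_le _ _).trans ?_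
    rw [norm_smul, norm_smul, Real.norm_of_nonneg hε.1,
      Real.norm_of_nonneg (sub_nonneg.mpr hε.2)]
    linarith
  simp only [realEnergy, Real.rpow_one, div_one, one_mul] at h2
  simp only [Pi.add_apply, zero_mul, add_zero]
  linarith

lemma IsMinimizer.toReal_anti (hβ : 1 ≤ β) (hts : t < s)
    (hu : IsMinimizer A J f α β t u) (hv : IsMinimizer A J f α β s v) :
    (J v).toReal ≤ (J u).toReal := by
  have h1 := hu.2 v hv.1
  have h2 := hv.2 u hu.1
  unfold realEnergy at h1 h2
  have hβ0 : 0 < β := by linarith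
  have h3 : (s - t) / β * (J v).toReal ^ β ≤ (s - t) / β * (J u).toReal ^ β := by
    rw [sub_div, sub_mul, sub_mul]
    linarith
  have h4 := le_of_mul_le_mul_left h3 (div_pos (sub_pos.mpr hts) hβ0)
  exact (Real.rpow_le_rpow_iff ENNReal.toReal_nonneg ENNReal.toReal_nonneg hβ0).mp h4

lemma IsMinimizer.realEnergy_le_zero (hJ : IsRegularizer J) (hβ : 1 ≤ β)
    (hu : IsMinimizer A J f α β t u) : realEnergy A J f α β t u ≤ 1 / α * ‖f‖ ^ α := by
  have h := hu.2 0 (by rw [hJ.map_zero]; exact ENNReal.zero_ne_top)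
  have hβ0 : β ≠ 0 := by linarith
  have h0 : realEnergy A J f α β t 0 = 1 / α * ‖f‖ ^ α := by
    simp [realEnergy, hJ.map_zero, Real.zero_rpow hβ0]
  rwa [h0] at h

lemma IsMinimizer.norm_sub_le (hJ : IsRegularizer J) (hα : 1 ≤ α) (hβ : 1 ≤ β) (ht : 0 < t)
    (hu : IsMinimizer A J f α β t u) : ‖A u - f‖ ≤ ‖f‖ := by
  have h := hu.realEnergy_le_zero hJ hβ
  unfold realEnergy at h
  have hα0 : 0 < α := by linarith
  have h1 : 0 ≤ t / β * (J u).toReal ^ β := by positivity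
  have h2 : 1 / α * ‖A u - f‖ ^ α ≤ 1 / α * ‖f‖ ^ α := by linarith
  have h3 := le_of_mul_le_mul_left h2 (by positivity)
  exact (Real.rpow_le_rpow_iff (norm_nonneg _) (norm_nonneg _) hα0).mp h3

lemma IsMinimizer.mul_rpow_le (hJ : IsRegularizer J) (hβ : 1 ≤ β)
    (hu : IsMinimizer A J f 1 β t u) : t * (J u).toReal ^ β ≤ β * ‖f‖ := by
  have h := hu.realEnergy_le_zero hJ hβ
  simp only [realEnergy, Real.rpow_one, div_one, one_mul] at h
  have hβ0 : 0 < β := by linarith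
  have h1 : t / β * (J u).toReal ^ β ≤ ‖f‖ := by linarith [norm_nonneg (A u - f)]
  rw [div_mul_eq_mul_div, div_le_iff₀ hβ0] at h1
  linarith

/-- If Au = f, then J(u) > 0. Moving from u towards 0 costs only order ε^α in the data term, with α
> 1, but gains order ε in the penalty, so u is not minimal. -/
lemma IsMinimizer.residual_pos (hJ : IsRegularizer J) (hf : ∀ u, A u = f → u ∉ nullSpace J)
    (hα : 1 < α) (hβ : 1 ≤ β) (ht : 0 < t) (hu : IsMinimizer A J f α β t u) :
    0 < ‖A u - f‖ := by
  by_contra h0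
  have h1 : A u - f = 0 := norm_le_zero_iff.mp (not_lt.mp h0)
  have h2 : J u ≠ 0 := hf u (sub_eq_zero.mp h1)
  have hj : 0 < (J u).toReal := ENNReal.toReal_pos h2 hu.1
  have hz : J 0 ≠ ∞ := by rw [hJ.map_zero]; exact ENNReal.zero_ne_top
  -- This is ε^α ‖f‖^α, in the shape to which `hasDerivAt_rpow_line` applies; its derivative at 0
  -- vanishes.
  have d1 : HasDerivAt (fun ε : ℝ => ‖f‖ ^ α * (α / α * (0 + ε * 1) ^ α))
      (‖f‖ ^ α * (α * 0 ^ (α - 1) * 1)) 0 := (hasDerivAt_rpow_line hα.le α 0 1).const_mul _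
  have d2 := (d1.const_mul (1 / α)).add
    (hasDerivAt_rpow_line hβ t (J u).toReal ((J 0).toReal - (J u).toReal))
  have hα0 : α ≠ 0 := by linarith
  have h3 := deriv_nonneg_of_forall_le d2 (fun ε hε => by
    have := hu.realEnergy_le_segment hJ hβ ht hz hε
    rw [realEnergy, h1, sub_eq_zero.mp h1, map_zero] at this
    simp only [norm_zero, Real.zero_rpow hα0, zero_add, zero_sub, norm_smul, norm_neg,
      Real.norm_of_nonneg hε.1, Real.mul_rpow hε.1 (norm_nonneg f)] at this
    simp only [Pi.add_apply, zero_mul, zero_add, add_zero, mul_one, div_self hα0, one_mul,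
      Real.zero_rpow hα0, mul_zero]
    linarith)
  rw [Real.zero_rpow (by linarith), hJ.map_zero] at h3
  have h4 : 0 < t * (J u).toReal ^ (β - 1) * (J u).toReal := by positivity
  simp only [mul_zero, zero_mul, ENNReal.toReal_zero, zero_add, zero_sub, mul_neg] at h3
  linarith

/-! ### Lipschitz dependence on the parameter and uniqueness of the image -/

lemma IsMinimizer.norm_map_sub_le_of_one_lt (hJ : IsRegularizer J)
    (hf : ∀ u, A u = f → u ∉ nullSpace J) (hα : 1 < α) (hα2 : α < 2) (hβ : 1 ≤ β) (ht : 0 < t)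
    (hts : t ≤ s) (hu : IsMinimizer A J f α β t u) (hv : IsMinimizer A J f α β s v)
    (hvu : (J v).toReal ≤ (J u).toReal) :
    ‖A v - A u‖ ≤ ‖A u - f‖ * ((s / t) ^ (1 / (α - 1)) - 1) :=
  VarReg.norm_sub_le_of_one_lt hα hα2 hβ ht hts ENNReal.toReal_nonneg hvu
    (hu.residual_pos hJ hf hα hβ ht) (hu.inner_le hJ hα.le hα2 hβ ht hv.1)
    (hv.inner_le hJ hα.le hα2 hβ (ht.trans_le hts) hu.1)

lemma IsMinimizer.norm_map_sub_le_of_eq_one (hJ : IsRegularizer J) (hβ : 1 < β) {δ : ℝ}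
    (hδ : 0 < δ) (hδt : δ ≤ t) (hts : t ≤ s) (hu : IsMinimizer A J f 1 β t u)
    (hv : IsMinimizer A J f 1 β s v) (hvu : (J v).toReal ≤ (J u).toReal) :
    ‖A v - A u‖ ≤ (β * ‖f‖ * max (1 / (β - 1)) 1 * ‖f‖ / δ ^ 2 +
      β * ‖f‖ * max (1 / (β - 1)) 1 / δ + 1) * (s - t) := by
  have ht : 0 < t := by linarith
  have hs : 0 < s := by linarith
  have h21 : (2 : ℝ) - 1 = 1 := by norm_num
  have h1 := hu.inner_le hJ le_rfl one_lt_two hβ.le ht hv.1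
  have h2 := hv.inner_le hJ le_rfl one_lt_two hβ.le hs hu.1
  rw [h21, Real.rpow_one] at h1 h2
  refine VarReg.norm_sub_le_of_eq_one hβ hδ hδt hts ENNReal.toReal_nonneg hvu
    (hu.mul_rpow_le hJ hβ.le) (hv.norm_sub_le hJ le_rfl hβ.le hs) h1 h2 ?_
  -- When the two linearized inequalities are added, the residuals cancel and the required
  -- monotonicity remains.
  have h3 := hu.linearized_le hJ hβ.le ht hv.1
  have h4 := hv.linearized_le hJ hβ.le hs hu.1
  linarith

/-- The images of minimizers depend on the parameter in a Lipschitz way, away from `0`. -/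
lemma exists_lipschitz_bound (hJ : IsRegularizer J) (hf : ∀ u, A u = f → u ∉ nullSpace J)
    (hα : 1 ≤ α) (hα2 : α < 2) (hβ : 1 ≤ β) (hαβ : 1 < α ∨ 1 < β) {δ : ℝ} (hδ : 0 < δ) :
    ∃ C : ℝ, 0 ≤ C ∧ ∀ t s, δ ≤ t → t ≤ s → ∀ u v, IsMinimizer A J f α β t u →
      IsMinimizer A J f α β s v → (J v).toReal ≤ (J u).toReal →
      ‖A v - A u‖ ≤ C * (s - t) := by
  rcases hα.eq_or_lt with rfl | hα1
  · have hβ1 : 1 < β := hαβ.resolve_left (lt_irrefl _)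
    exact ⟨_, by positivity, fun t s hδt hts u v hu hv hvu =>
      hu.norm_map_sub_le_of_eq_one hJ hβ1 hδ hδt hts hv hvu⟩
  set p := 1 / (α - 1) with hp
  have hp0 : 0 ≤ p := by
    have : 0 < α - 1 := by linarith
    positivity
  set C := ‖f‖ * (2 ^ p * max p 1) + 2 * ‖f‖ with hC
  refine ⟨C / δ, by positivity, fun t s hδt hts u v hu hv hvu => ?_⟩
  have ht : 0 < t := by linarith
  have hs : 0 < s := by linarith
  have hRu := hu.norm_sub_le hJ hα hβ ht
  have hRv := hv.norm_sub_le hJ hα hβ hs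
  -- For s ≤ 2t the factor (s/t)^p is at most 2^p and the power estimate is linear in s - t. For s ≥
  -- 2t one has s - t ≥ δ, and the trivial bound 2‖f‖ on the distance suffices.
  rcases le_total s (2 * t) with h | h
  · have h1 := hu.norm_map_sub_le_of_one_lt hJ hf hα1 hα2 hβ ht hts hv hvu
    have hst : 0 < s / t := by positivity
    have h2 : (s / t) ^ p - 1 = (s / t) ^ p * (1 - (t / s) ^ p) := by
      rw [mul_sub, ← Real.mul_rpow hst.le (by positivity), div_mul_div_cancel₀ ht.ne',
        div_self hs.ne', Real.one_rpow, mul_one]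
    have h3 : (s / t) ^ p ≤ 2 ^ p :=
      Real.rpow_le_rpow hst.le ((div_le_iff₀ ht).mpr h) hp0
    have h4 := one_sub_rpow_le (r := t / s) (p := p) (by positivity) ((div_le_one hs).mpr hts)
    have h5 : 1 - t / s ≤ (s - t) / δ := by
      rw [one_sub_div hs.ne']
      exact div_le_div_of_nonneg_left (sub_nonneg.mpr hts) hδ (hδt.trans hts)
    have h6 : 0 ≤ 1 - (t / s) ^ p := sub_nonneg.mpr
      (Real.rpow_le_one (by positivity) ((div_le_one hs).mpr hts) hp0)
    have hst0 : 0 ≤ s - t := sub_nonneg.mpr hts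
    calc ‖A v - A u‖ ≤ ‖A u - f‖ * ((s / t) ^ p * (1 - (t / s) ^ p)) := by rw [← h2]; exact h1
      _ ≤ ‖f‖ * (2 ^ p * (max p 1 * ((s - t) / δ))) := by
          gcongr
          exact h4.trans (mul_le_mul_of_nonneg_left h5 (by positivity))
      _ = ‖f‖ * (2 ^ p * max p 1) / δ * (s - t) := by ring
      _ ≤ C / δ * (s - t) := by
          rw [hC]
          gcongr
          linarith [norm_nonneg f]
  · have h1 : ‖A v - A u‖ ≤ 2 * ‖f‖ := by
      have := norm_sub_le (A v - f) (A u - f)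
      rw [sub_sub_sub_cancel_right] at this
      linarith
    have h2 : 1 ≤ (s - t) / δ := (one_le_div hδ).mpr (by linarith)
    calc ‖A v - A u‖ ≤ 2 * ‖f‖ * 1 := by rw [mul_one]; exact h1
      _ ≤ C * ((s - t) / δ) := by
          refine mul_le_mul ?_ h2 zero_le_one (by positivity)
          rw [hC]
          have : 0 ≤ ‖f‖ * (2 ^ p * max p 1) := by positivity
          linarith
      _ = C / δ * (s - t) := by ring

/-- The Lipschitz bound allows s = t, where it gives distance 0. At equal parameters nothing orders
the values of J in advance, so both orders are treated. -/
lemma IsMinimizer.map_eq_map (hJ : IsRegularizer J) (hf : ∀ u, A u = f → u ∉ nullSpace J)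
    (hα : 1 ≤ α) (hα2 : α < 2) (hβ : 1 ≤ β) (hαβ : 1 < α ∨ 1 < β) (ht : 0 < t)
    (hu : IsMinimizer A J f α β t u) (hv : IsMinimizer A J f α β t v) : A v = A u := by
  obtain ⟨C, -, hC⟩ := exists_lipschitz_bound hJ hf hα hα2 hβ hαβ ht
  rcases le_total (J v).toReal (J u).toReal with h | h
  · have := hC t t le_rfl le_rfl u v hu hv h
    rw [sub_self, mul_zero] at this
    exact sub_eq_zero.mp (norm_le_zero_iff.mp this)
  · have := hC t t le_rfl le_rfl v u hv hu h
    rw [sub_self, mul_zero] at this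
    exact (sub_eq_zero.mp (norm_le_zero_iff.mp this)).symm

lemma forwardSolutions_eq_singleton (hJ : IsRegularizer J)
    (hf : ∀ u, A u = f → u ∉ nullSpace J) (hα : 1 ≤ α) (hα2 : α < 2) (hβ : 1 ≤ β)
    (hαβ : 1 < α ∨ 1 < β) (ht : 0 < t) (hu : IsMinimizer A J f α β t u) :
    forwardSolutions A J f α β t = {A u} := by
  ext y
  simp only [forwardSolutions, Set.mem_image, Set.mem_ofPred_eq, Set.mem_singleton_iff,
    isMinOn_energy_iff hJ hα hβ ht]
  constructor
  · rintro ⟨v, hv, rfl⟩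
    exact hu.map_eq_map hJ hf hα hα2 hβ hαβ ht hv
  · rintro rfl
    exact ⟨u, hu, rfl⟩

/-! ### Residual rates under the range and source conditions -/

/-- Residual estimate against an exact solution, for `β = 1`. -/
lemma IsMinimizer.residual_rpow_le (hJ : IsRegularizer J) (hα : 1 ≤ α) (hα2 : α < 2)
    (ht : 0 < t) (hu : IsMinimizer A J f α 1 t u) (hR : 0 < ‖A u - f‖) (hv : J v ≠ ∞)
    (hvf : A v = f) : ‖A u - f‖ ^ α ≤ t * ((J v).toReal - (J u).toReal) := by
  have h := hu.inner_le hJ hα hα2 le_rfl ht hv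
  rw [hvf, real_inner_self_eq_norm_sq, norm_sub_rev f, sub_self, Real.rpow_zero, mul_one] at h
  have h1 : ‖A u - f‖ ^ 2 = ‖A u - f‖ ^ (2 - α) * ‖A u - f‖ ^ α := by
    rw [← Real.rpow_add hR]; norm_num
  rw [h1] at h
  refine le_of_mul_le_mul_left ?_ (Real.rpow_pos_of_pos hR (2 - α))
  linarith

lemma IsMinimizer.residual_div_le_range (hJ : IsRegularizer J) (hα : 1 ≤ α) (hα2 : α < 2)
    (ht : 0 < t) (hu : IsMinimizer A J f α 1 t u) (hR : 0 < ‖A u - f‖)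
    (hr : RangeCond A J f) :
    ‖A u - f‖ / t ≤ rangeConst A J f α 1 * t ^ ((1 - α) / α) := by
  have hα0 : 0 < α := by linarith
  -- The infimum is taken in [0, ∞], where solutions outside dom J impose no condition; the range
  -- condition makes it finite.
  have h1 : ENNReal.ofReal (‖A u - f‖ ^ α / t) ≤ sInf (J '' {w | A w = f}) := by
    refine le_sInf ?_
    rintro _ ⟨w, hw, rfl⟩
    by_cases hwd : J w = ∞
    · rw [hwd]; exact le_top
    refine ENNReal.ofReal_le_of_le_toReal ?_
    rw [div_le_iff₀ ht]
    have := hu.residual_rpow_le hJ hα hα2 ht hR hwd hw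
    have h0 : 0 ≤ t * (J u).toReal := by positivity
    linarith
  obtain ⟨w, hw, hwf⟩ := hr
  have hfin : sInf (J '' {w | A w = f}) ≠ ∞ :=
    ne_top_of_le_ne_top hw (sInf_le ⟨w, hwf, rfl⟩)
  have h2 : ‖A u - f‖ ^ α / t ≤ Jmin A J f := (ENNReal.ofReal_le_iff_le_toReal hfin).mp h1
  have hJm : 0 ≤ Jmin A J f := ENNReal.toReal_nonneg
  rw [div_le_iff₀ ht] at h2
  have h3 : ‖A u - f‖ ≤ (Jmin A J f * t) ^ α⁻¹ :=
    (Real.le_rpow_inv_iff_of_pos (norm_nonneg _) (by positivity) hα0).mpr h2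
  rw [Real.mul_rpow hJm ht.le] at h3
  have h4 : t ^ α⁻¹ = t ^ ((1 - α) / α) * t := by
    rw [← Real.rpow_add_one ht.ne']
    congr 1
    field_simp
    ring
  rw [div_le_iff₀ ht, rangeConst, one_div, mul_assoc, ← h4]
  exact h3

lemma toReal_sub_le_of_mem_subdiff {q : H} {w : StrongDual ℝ Y} (hq : adj A q ∈ subdiff J w)
    (hwf : A w = f) (hu : J u ≠ ∞) : (J w).toReal - (J u).toReal ≤ ‖q‖ * ‖A u - f‖ := by
  obtain ⟨hw, h⟩ := hq
  have h1 := h u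
  rw [← ENNReal.ofReal_toReal hw, ← ENNReal.ofReal_toReal hu, EReal.coe_ennreal_ofReal,
    EReal.coe_ennreal_ofReal, max_eq_left ENNReal.toReal_nonneg,
    max_eq_left ENNReal.toReal_nonneg] at h1
  have h2 : (J w).toReal + adj A q (u - w) ≤ (J u).toReal := by exact_mod_cast h1
  have h3 : adj A q (u - w) = inner ℝ q (A u - f) := by
    simp [adj, hwf]
  have h4 : -(inner ℝ q (A u - f)) ≤ ‖q‖ * ‖A u - f‖ :=
    (neg_le_abs _).trans (abs_real_inner_le_norm _ _)
  rw [h3] at h2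
  linarith

lemma IsMinimizer.residual_div_le_source (hJ : IsRegularizer J) (hα : 1 < α) (hα2 : α < 2)
    (ht : 0 < t) (hu : IsMinimizer A J f α 1 t u) (hR : 0 < ‖A u - f‖)
    (hr : RangeSourceCond A J f) :
    ‖A u - f‖ / t ≤ sourceConst A J f α 1 * t ^ ((2 - α) / (α - 1)) := by
  have hα1 : 0 < α - 1 := by linarith
  -- For each source element q the subgradient inequality gives R^α ≤ t‖q‖R; one power of R cancels.
  have h1 : ‖A u - f‖ ^ (α - 1) / t ≤ sStar A J f := by
    refine le_csInf (Set.Nonempty.image norm hr) ?_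
    rintro _ ⟨q, ⟨w, ⟨hw, hwf⟩, hq⟩, rfl⟩
    have e1 := hu.residual_rpow_le hJ hα.le hα2 ht hR hw hwf
    have e2 := mul_le_mul_of_nonneg_left (toReal_sub_le_of_mem_subdiff hq hwf hu.1) ht.le
    have e3 : ‖A u - f‖ ^ α = ‖A u - f‖ ^ (α - 1) * ‖A u - f‖ := by
      rw [← Real.rpow_add_one hR.ne']; norm_num
    rw [div_le_iff₀ ht]
    refine le_of_mul_le_mul_right ?_ hR
    linarith
  have hs : 0 ≤ sStar A J f := le_trans (by positivity) h1
  rw [div_le_iff₀ ht] at h1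
  have h3 : ‖A u - f‖ ≤ (sStar A J f * t) ^ (α - 1)⁻¹ :=
    (Real.le_rpow_inv_iff_of_pos (norm_nonneg _) (by positivity) hα1).mpr h1
  rw [Real.mul_rpow hs ht.le] at h3
  have h4 : t ^ (α - 1)⁻¹ = t ^ ((2 - α) / (α - 1)) * t := by
    rw [← Real.rpow_add_one ht.ne']
    congr 1
    field_simp
    ring
  rw [div_le_iff₀ ht, sourceConst, sub_self, zero_div, Real.rpow_zero, mul_one, one_div,
    mul_assoc, ← h4]
  exact h3

end Minimizers

/-! ### Derivative bounds and the main theorem -/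

/-- Right difference quotients of F are dominated by those of R (s/t)^p, whose derivative at s = t
is pR/t; as F is differentiable at t, the right-hand limit determines its derivative. -/
lemma norm_deriv_le_of_rpow_bound {E : Type*} [NormedAddCommGroup E] [NormedSpace ℝ E]
    {F : ℝ → E} {t R p : ℝ} (ht : 0 < t) (hF : DifferentiableAt ℝ F t)
    (h : ∀ s, t < s → ‖F s - F t‖ ≤ R * ((s / t) ^ p - 1)) : ‖deriv F t‖ ≤ p * (R / t) := by
  have hsub : Set.Ioi t ⊆ {t}ᶜ := fun x hx => ne_of_gt hx
  have h1 := ((hasDerivAt_iff_tendsto_slope.mp hF.hasDerivAt).mono_left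
    (nhdsWithin_mono t hsub)).norm
  have hd : HasDerivAt (fun s : ℝ => R * (s / t) ^ p) (p * (R / t)) t := by
    have := (((hasDerivAt_id t).div_const t).rpow_const (p := p)
      (Or.inl (by simp [ht.ne']))).const_mul R
    refine this.congr_deriv ?_
    simp [div_self ht.ne']
    ring
  have h2 := (hasDerivAt_iff_tendsto_slope.mp hd).mono_left (nhdsWithin_mono t hsub)
  refine le_of_tendsto_of_tendsto h1 h2 ?_
  filter_upwards [self_mem_nhdsWithin] with s hs
  have hs' : 0 < s - t := sub_pos.mpr hs
  rw [slope_def_module, slope_def_field, norm_smul, norm_inv, Real.norm_of_nonneg hs'.le,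
    inv_mul_eq_div, div_self ht.ne', Real.one_rpow]
  gcongr
  linarith [h s hs]

end VarReg
theorem mainTheorem7
    {Y : Type*} [NormedAddCommGroup Y] [NormedSpace ℝ Y] [CompleteSpace Y]
    [TopologicalSpace.SeparableSpace Y]
    {H : Type*} [NormedAddCommGroup H] [InnerProductSpace ℝ H] [CompleteSpace H]
    (A : StrongDual ℝ Y →L[ℝ] H) (J : StrongDual ℝ Y → ℝ≥0∞)
    (hJ : VarReg.IsRegularizer J)
    (hA : VarReg.NormEquivOnNull A J)
    (hP : VarReg.PoincareIneq A J)
    (hW : VarReg.WeakStarToWeak A)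
    (f : H) (hf : ∀ u, A u = f → u ∉ VarReg.nullSpace J)
    (α β : ℝ) (hα : 1 ≤ α) (hα2 : α < 2) (hβ : 1 ≤ β) (hαβ : 1 < α ∨ 1 < β) :
    ∃ F : ℝ → H,
      (∀ t > 0, VarReg.forwardSolutions A J f α β t = {F t}) ∧
      (∀ δ > 0, (∃ L : ℝ≥0, LipschitzOnWith L F (Set.Ioi δ)) ∧
        ∀ᵐ t ∂(MeasureTheory.volume.restrict (Set.Ioi δ)), DifferentiableAt ℝ F t) ∧
      (1 < α → β = 1 →
        (∀ᵐ t ∂(MeasureTheory.volume.restrict (Set.Ioi (0 : ℝ))),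
          ‖deriv F t‖ ≤ 1 / (α - 1) * (‖F t - f‖ / t) ∧
          1 / (α - 1) * (‖F t - f‖ / t) ≤ 1 / (α - 1) * (‖f‖ / t)) ∧
        (VarReg.RangeCond A J f →
          ∀ᵐ t ∂(MeasureTheory.volume.restrict (Set.Ioi (0 : ℝ))),
            ‖deriv F t‖ ≤ 1 / (α - 1) * VarReg.rangeConst A J f α β * t ^ ((1 - α) / α)) ∧
        (VarReg.RangeSourceCond A J f →
          ∀ᵐ t ∂(MeasureTheory.volume.restrict (Set.Ioi (0 : ℝ))),
            ‖deriv F t‖ ≤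
              1 / (α - 1) * VarReg.sourceConst A J f α β * t ^ ((2 - α) / (α - 1)))) := by
  -- One minimizer is selected for each t > 0, with an arbitrary value elsewhere; J decreases along
  -- any such selection.
  have hex : ∀ t : ℝ, ∃ u, 0 < t → VarReg.IsMinimizer A J f α β t u := by
    intro t
    by_cases ht : 0 < t
    · obtain ⟨u, hu⟩ := VarReg.exists_isMinimizer hJ hA hP hW f hα hβ ht
      exact ⟨u, fun _ => hu⟩
    · exact ⟨0, fun h => absurd h ht⟩
  choose u hu using hex
  have hanti : ∀ t s, 0 < t → t < s → (J (u s)).toReal ≤ (J (u t)).toReal :=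
    fun t s ht hts => (hu t ht).toReal_anti hβ hts (hu s (ht.trans hts))
  have hLip : ∀ δ > 0, ∃ L : ℝ≥0, LipschitzOnWith L (fun t => A (u t)) (Set.Ioi δ) := by
    intro δ hδ
    obtain ⟨C, hC0, hC⟩ := VarReg.exists_lipschitz_bound hJ hf hα hα2 hβ hαβ hδ
    have key : ∀ t s, δ < t → t < s → ‖A (u s) - A (u t)‖ ≤ C * (s - t) := fun t s ht hts =>
      hC t s ht.le hts.le _ _ (hu t (hδ.trans ht)) (hu s (hδ.trans (ht.trans hts)))
        (hanti t s (hδ.trans ht) hts)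
    refine ⟨⟨C, hC0⟩, LipschitzOnWith.of_dist_le_mul fun x hx y hy => ?_⟩
    rw [dist_eq_norm, Real.dist_eq]
    change _ ≤ C * _
    rcases lt_trichotomy x y with h | h | h
    · rw [norm_sub_rev, abs_sub_comm, abs_of_pos (sub_pos.mpr h)]
      exact key x y hx h
    · simp [h]
    · rw [abs_of_pos (sub_pos.mpr h)]
      exact key y x hy h
  have hdiff := VarReg.ae_differentiableAt_of_lipschitzOn_Ioi hLip
  have hdiff0 : ∀ᵐ t ∂(MeasureTheory.volume.restrict (Set.Ioi (0 : ℝ))),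
      0 < t ∧ DifferentiableAt ℝ (fun t => A (u t)) t := by
    rw [MeasureTheory.ae_restrict_iff' measurableSet_Ioi]
    -- The half-line (0, ∞) is exhausted by countably many (1/(n+1), ∞), so the exceptional sets
    -- still form a null set.
    have hall : ∀ᵐ t : ℝ, ∀ n : ℕ, t ∈ Set.Ioi (1 / ((n : ℝ) + 1)) →
        DifferentiableAt ℝ (fun t => A (u t)) t :=
      MeasureTheory.ae_all_iff.mpr fun n =>
        (MeasureTheory.ae_restrict_iff' measurableSet_Ioi).mp (hdiff _ (by positivity))
    filter_upwards [hall] with t ht ht0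
    obtain ⟨n, hn⟩ := exists_nat_one_div_lt (Set.mem_Ioi.mp ht0)
    exact ⟨ht0, ht n hn⟩
  refine ⟨fun t => A (u t), fun t ht => VarReg.forwardSolutions_eq_singleton hJ hf hα hα2 hβ hαβ
    ht (hu t ht), fun δ hδ => ⟨hLip δ hδ, hdiff δ hδ⟩, ?_⟩
  rintro hα1 rfl
  have hα0 : 0 < α - 1 := by linarith
  have hpos : ∀ t > 0, 0 < ‖A (u t) - f‖ := fun t ht =>
    (hu t ht).residual_pos hJ hf hα1 le_rfl ht
  have hder : ∀ t, 0 < t → DifferentiableAt ℝ (fun t => A (u t)) t →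
      ‖deriv (fun t => A (u t)) t‖ ≤ 1 / (α - 1) * (‖A (u t) - f‖ / t) := fun t ht hd =>
    VarReg.norm_deriv_le_of_rpow_bound ht hd fun s hs =>
      (hu t ht).norm_map_sub_le_of_one_lt hJ hf hα1 hα2 le_rfl ht (le_of_lt hs)
        (hu s (ht.trans hs)) (hanti t s ht hs)
  refine ⟨?_, fun hr => ?_, fun hr => ?_⟩
  · filter_upwards [hdiff0] with t ht
    refine ⟨hder t ht.1 ht.2, ?_⟩
    have h1 := (hu t ht.1).norm_sub_le hJ hα le_rfl ht.1
    have h2 := ht.1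
    gcongr
  · filter_upwards [hdiff0] with t ht
    refine (hder t ht.1 ht.2).trans ?_
    rw [mul_assoc]
    gcongr
    exact (hu t ht.1).residual_div_le_range hJ hα hα2 ht.1 (hpos t ht.1) hr
  · filter_upwards [hdiff0] with t ht
    refine (hder t ht.1 ht.2).trans ?_
    rw [mul_assoc]
    gcongr
    exact (hu t ht.1).residual_div_le_source hJ hα1 hα2 ht.1 (hpos t ht.1) hr
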